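/- Let $G=(V,E,b)$ be a connected power network: a finite connected simple graph whose edges (lines) $\ell\in E$ carry susceptances $b_\ell>0$ and a fixed arbitrary orientation. Let $C\in\{-1,0,1\}^{V\times E}$ be the incidence matrix ($C_{i\ell}=1$ if $i$ is the source of $\ell$, $-1$ if $i$ is the target, $0$ otherwise) and $B=\mathrm{diag}(b_\ell)$. For power injections $p\in\mathbb R^V$ a DC power flow is a vector $f\in\mathbb R^E$ with $p=Cf$ and $f=BC^T\theta$ for some $\theta\in\mathbb R^V$; the injections for which one exists are called balanced. For lines $\ell$ and $\hat\ell=(s,t)$ (oriented from $s$ to $t$), the power transfer distribution factor (PTDF) $D_{\ell\hat\ell}$ is the change $(\tilde f_\ell-f_\ell)/\delta$, where $f$ and $\tilde f$ are the DC power flows for balanced injections $p$ and for $p+\delta(\mathbf e_s-\mathbf e_t)$, $\delta\ne 0$. If $\hat\ell$ is not a bridge and $\ell\neq\hat\ell$, the line outage distribution factor (LODF) $K_{\ell\hat\ell}$ is $(\tilde f_\ell-f_\ell)/f_{\hat\ell}$, where $f$ is the DC power flow on $G$ and $\tilde f$ the DC power flow on the surviving network $(V,E\setminus\{\hat\ell\},b)$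 for the same balanced injections $p$, with $f_{\hat\ell}\neq0$. Two lines lie in the same block of $G$ if they are equal or lie on a common simple cycle of $G$; this is an equivalence relation on $E$. **Proposition.** Let $\hat\ell\in E$ be a non-bridge line and let $\ell\in E$, $\ell\neq\hat\ell$. Then the PTDF $D_{\ell\hat\ell}$ and the LODF $K_{\ell\hat\ell}$ are well defined (each ratio above can be formed and has one and the same value for all admissible choices of $p$ and $\delta$), and (i) $D_{\ell\hat\ell}=0$ if and only if $K_{\ell\hat\ell}=0$; (ii) if $\ell$ and $\hat\ell$ lie in different blocks of $G$, then $K_{\ell\hat\ell}=0$ and $D_{\ell\hat\ell}=0$. -/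

import Mathlib

/-- A power network `(V, E, b)`: a simple undirected graph on the buses `V`, whose lines carry an
arbitrary fixed orientation (the line `(i, j)` has source `i` and target `j`), together with a
positive susceptance for each line. Only the values of `susceptance` on `lines` are relevant. -/
structure PowerNetwork (V : Type*) where
  lines : Finset (V × V)
  no_loop : ∀ ℓ ∈ lines, ℓ.1 ≠ ℓ.2
  no_parallel : ∀ ℓ ∈ lines, ℓ.swap ∉ lines
  susceptance : V × V → ℝ
  susceptance_pos : ∀ ℓ ∈ lines, 0 < susceptance ℓ

namespace PowerNetwork

/-- The underlying undirected graph. -/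
def graph {V : Type*} (N : PowerNetwork V) : SimpleGraph V :=
  SimpleGraph.fromRel fun i j => (i, j) ∈ N.lines

/-- The surviving network after the outage of the line `e`. -/
def removeLine {V : Type*} [DecidableEq V] (N : PowerNetwork V) (e : V × V) :
    PowerNetwork V where
  lines := N.lines.erase e
  no_loop ℓ hℓ := N.no_loop ℓ (Finset.mem_of_mem_erase hℓ)
  no_parallel ℓ hℓ h := N.no_parallel ℓ (Finset.mem_of_mem_erase hℓ) (Finset.mem_of_mem_erase h)
  susceptance := N.susceptance
  susceptance_pos ℓ hℓ := N.susceptance_pos ℓ (Finset.mem_of_mem_erase hℓ)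

/-- The entry `C i ℓ` of the vertex-edge incidence matrix: `1` if `i` is the source of `ℓ`, `-1` if
it is the target, and `0` otherwise. -/
def incidence {V : Type*} [DecidableEq V] (i : V) (ℓ : V × V) : ℝ :=
  if i = ℓ.1 then 1 else if i = ℓ.2 then -1 else 0

/-- `f` is a solution of the DC power flow equations `p = C f`, `f = B Cᵀ θ` (for some vector `θ`
of phase angles) with power injections `p`. Only the values of `f` on the lines are relevant. -/
def IsDCFlow {V : Type*} [Fintype V] [DecidableEq V] (N : PowerNetwork V)
    (p : V → ℝ) (f : V × V → ℝ) : Prop :=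
  (∀ i, p i = ∑ ℓ ∈ N.lines, incidence i ℓ * f ℓ) ∧
    ∃ θ : V → ℝ, ∀ ℓ ∈ N.lines, f ℓ = N.susceptance ℓ * ∑ i, incidence i ℓ * θ i

/-- `D` is the power transfer distribution factor of the line `ℓ` with respect to the nodes `s`
and `t`: whenever the injections change from `p` to `p + δ (e_s - e_t)` with `δ ≠ 0`, the resulting
change of the flow on `ℓ`, normalized by `δ`, is `D`. -/
def IsPTDF {V : Type*} [Fintype V] [DecidableEq V] (N : PowerNetwork V)
    (ℓ : V × V) (s t : V) (D : ℝ) : Prop :=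
  ∀ (p : V → ℝ) (δ : ℝ) (f f' : V × V → ℝ), δ ≠ 0 →
    N.IsDCFlow p f → N.IsDCFlow (p + δ • (Pi.single s 1 - Pi.single t 1)) f' →
      D = (f' ℓ - f ℓ) / δ

/-- `K` is the line outage distribution factor of the surviving line `ℓ` with respect to the
outaged line `e`: whenever `e` trips while the injections `p` remain unchanged, the resulting change
of the flow on `ℓ`, normalized by the pre-contingency flow `f e ≠ 0`, is `K`. -/
def IsLODF {V : Type*} [Fintype V] [DecidableEq V] (N : PowerNetwork V)
    (ℓ e : V × V) (K : ℝ) : Prop :=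
  ∀ (p : V → ℝ) (f f' : V × V → ℝ), N.IsDCFlow p f → (N.removeLine e).IsDCFlow p f' →
    f e ≠ 0 → K = (f' ℓ - f ℓ) / f e

/-- Two lines belong to the same block if they are equal or lie on a common simple cycle. This is
the equivalence relation on the lines whose classes are the (edge sets of the) blocks; a line that
lies on no cycle forms a trivial block. -/
def SameBlock {V : Type*} (N : PowerNetwork V) (ℓ e : V × V) : Prop :=
  ℓ = e ∨ ∃ (v : V) (c : N.graph.Walk v v),
    c.IsCycle ∧ s(ℓ.1, ℓ.2) ∈ c.edges ∧ s(e.1, e.2) ∈ c.edges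

end PowerNetwork

namespace PowerNetwork

/-! Write `L` for the Laplacian and choose `θ` with `L θ = e_s - e_t`, where `e = (s, t)`. The flow
of `θ` on `ℓ` is `D`; let `F` be its flow on `e`. Removing `e` subtracts a multiple of `e_s - e_t`
from `L`, so the outage acts like a transfer of size `f e / (1 - F)`, and `K = D / (1 - F)`. Here `F
≠ 1` because `e` is not a bridge (`flow_ne_one`), which gives (i). For (ii), flow on `ℓ` can be
followed downhill to the only sink `t` and uphill to the only source `s`. The two paths are
separated by their potentials, so together with `ℓ` and `e` they form a simple cycle
(`exists_isCycle_of_lt`). -/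

theorem sum_incidence_mul {V : Type*} [Fintype V] [DecidableEq V] {ℓ : V × V} (h : ℓ.1 ≠ ℓ.2)
    (θ : V → ℝ) : ∑ i, incidence i ℓ * θ i = θ ℓ.1 - θ ℓ.2 := by
  have key : ∀ i, incidence i ℓ * θ i =
      (if i = ℓ.1 then θ i else 0) - (if i = ℓ.2 then θ i else 0) := by
    intro i
    unfold incidence
    split_ifs with h1 h2 <;> simp
    exact absurd (h1.symm.trans h2) h
  simp [key, Finset.sum_sub_distrib]

/-- The weighted graph Laplacian `C B Cᵀ` of a power network. -/
noncomputable def laplacian {V : Type*} [DecidableEq V] (N : PowerNetwork V) :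
    (V → ℝ) →ₗ[ℝ] (V → ℝ) where
  toFun θ i := ∑ ℓ ∈ N.lines, incidence i ℓ * (N.susceptance ℓ * (θ ℓ.1 - θ ℓ.2))
  map_add' θ φ := by
    ext i
    simp only [Pi.add_apply, ← Finset.sum_add_distrib]
    exact Finset.sum_congr rfl fun _ _ => by ring
  map_smul' c θ := by
    ext i
    simp only [Pi.smul_apply, smul_eq_mul, Finset.mul_sum, RingHom.id_apply]
    exact Finset.sum_congr rfl fun _ _ => by ring

section

variable {V : Type*} (N : PowerNetwork V)

theorem graph_adj_of_mem {ℓ : V × V} (h : ℓ ∈ N.lines) : N.graph.Adj ℓ.1 ℓ.2 := by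
  simp only [graph, SimpleGraph.fromRel_adj]
  exact ⟨N.no_loop ℓ h, Or.inl h⟩

theorem edge_injective_of_mem {ℓ e : V × V} (hℓ : ℓ ∈ N.lines) (he : e ∈ N.lines)
    (h : s(ℓ.1, ℓ.2) = s(e.1, e.2)) : ℓ = e := by
  rcases Sym2.eq_iff.1 h with ⟨h1, h2⟩ | ⟨h1, h2⟩
  · exact Prod.ext h1 h2
  · have : ℓ.swap = e := Prod.ext h2 h1
    exact absurd (this ▸ he) (N.no_parallel ℓ hℓ)

theorem eq_of_reachable {θ : V → ℝ} (h : ∀ ℓ ∈ N.lines, θ ℓ.1 = θ ℓ.2) {u v : V}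
    (huv : N.graph.Reachable u v) : θ u = θ v := by
  obtain ⟨w⟩ := huv
  induction w with
  | nil => rfl
  | cons hadj _ ih =>
    rw [← ih]
    simp only [graph, SimpleGraph.fromRel_adj] at hadj
    rcases hadj.2 with h' | h'
    · exact h _ h'
    · exact (h _ h').symm

variable [DecidableEq V]

theorem laplacian_apply (θ : V → ℝ) (i : V) :
    N.laplacian θ i =
      ∑ ℓ ∈ N.lines, incidence i ℓ * (N.susceptance ℓ * (θ ℓ.1 - θ ℓ.2)) := rfl

theorem laplacian_removeLine {e : V × V} (he : e ∈ N.lines) (θ : V → ℝ) :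
    (N.removeLine e).laplacian θ = N.laplacian θ -
      (N.susceptance e * (θ e.1 - θ e.2)) • (Pi.single e.1 1 - Pi.single e.2 1) := by
  ext i
  have h := Finset.add_sum_erase N.lines
    (fun ℓ => incidence i ℓ * (N.susceptance ℓ * (θ ℓ.1 - θ ℓ.2))) he
  have hi : incidence i e = (Pi.single e.1 (1 : ℝ) - Pi.single e.2 1 : V → ℝ) i := by
    have := N.no_loop e he
    simp only [incidence, Pi.sub_apply, Pi.single_apply]
    split_ifs with h1 h2 <;> simp
    exact this (h1.symm.trans h2)
  simp only [laplacian_apply, removeLine, Pi.sub_apply, Pi.smul_apply, smul_eq_mul] at h hi ⊢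
  rw [← h, ← hi]
  ring

/-- Discrete maximum principle: flow entering a bus that is not a net consumer must leave it again.
Otherwise every term of the Laplacian at `v` is nonpositive, and the term of the line `uv` is
negative. -/
theorem exists_adj_lt {θ : V → ℝ} {u v : V} (hv : 0 ≤ N.laplacian θ v) (huv : N.graph.Adj u v)
    (hlt : θ v < θ u) : ∃ w, N.graph.Adj v w ∧ θ w < θ v := by
  by_contra! hall
  refine absurd hv (not_le.2 ?_)
  rw [laplacian_apply]
  have hle : ∀ ℓ ∈ N.lines, incidence v ℓ * (N.susceptance ℓ * (θ ℓ.1 - θ ℓ.2)) ≤ 0 := by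
    intro ℓ hℓ
    have hb := (N.susceptance_pos ℓ hℓ).le
    have hadj := N.graph_adj_of_mem hℓ
    unfold incidence
    split_ifs with h1 h2
    · subst h1
      have := hall _ hadj
      rw [one_mul]
      exact mul_nonpos_of_nonneg_of_nonpos hb (by linarith)
    · subst h2
      have := mul_nonneg hb (sub_nonneg.2 (hall _ hadj.symm))
      linarith
    · simp
  refine Finset.sum_neg' hle ?_
  simp only [graph, SimpleGraph.fromRel_adj] at huv
  rcases huv.2 with h | h
  · refine ⟨_, h, ?_⟩
    have := mul_pos (N.susceptance_pos _ h) (sub_pos.2 hlt)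
    simpa [incidence, huv.1.symm] using this
  · refine ⟨_, h, ?_⟩
    have := mul_pos (N.susceptance_pos _ h) (sub_pos.2 hlt)
    simp only [incidence, if_true, one_mul]
    linarith

theorem reachable_removeLine {e : V × V} (he : e ∈ N.lines)
    (hbridge : ¬ N.graph.IsBridge s(e.1, e.2)) : (N.removeLine e).graph.Reachable e.1 e.2 := by
  rw [SimpleGraph.isBridge_iff] at hbridge
  have h : (N.graph.deleteEdges {s(e.1, e.2)}).Reachable e.1 e.2 := by
    by_contra h
    exact hbridge h
  refine h.mono fun a b hab => ?_
  simp only [SimpleGraph.deleteEdges_adj, graph, SimpleGraph.fromRel_adj, removeLine,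
    Set.mem_singleton_iff, Finset.mem_erase] at hab ⊢
  obtain ⟨⟨hne, hor⟩, hs⟩ := hab
  refine ⟨hne, hor.imp (fun hm => ⟨?_, hm⟩) fun hm => ⟨?_, hm⟩⟩
  · rintro rfl
    exact hs rfl
  · rintro rfl
    exact hs Sym2.eq_swap

theorem laplacian_ne_zero_of_eq_single_sub {θ : V → ℝ} {e : V × V} (he : e ∈ N.lines)
    (hθ : N.laplacian θ = Pi.single e.1 1 - Pi.single e.2 1) : N.laplacian θ ≠ 0 := by
  intro h
  have := congrFun (hθ.symm.trans h) e.1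
  simp [Pi.single_eq_of_ne (N.no_loop e he)] at this

variable [Fintype V]

/-! ### Energy, uniqueness and solvability -/

theorem isDCFlow_iff {p : V → ℝ} {f : V × V → ℝ} :
    N.IsDCFlow p f ↔ ∃ θ : V → ℝ, N.laplacian θ = p ∧
      ∀ ℓ ∈ N.lines, f ℓ = N.susceptance ℓ * (θ ℓ.1 - θ ℓ.2) := by
  constructor
  · rintro ⟨hp, θ, hθ⟩
    have hf : ∀ ℓ ∈ N.lines, f ℓ = N.susceptance ℓ * (θ ℓ.1 - θ ℓ.2) := fun ℓ hℓ => by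
      rw [hθ ℓ hℓ, sum_incidence_mul (N.no_loop ℓ hℓ)]
    refine ⟨θ, funext fun i => ?_, hf⟩
    rw [hp i, laplacian_apply]
    exact Finset.sum_congr rfl fun ℓ hℓ => by rw [hf ℓ hℓ]
  · rintro ⟨θ, rfl, hf⟩
    refine ⟨fun i => Finset.sum_congr rfl fun ℓ hℓ => by rw [hf ℓ hℓ], θ, fun ℓ hℓ => ?_⟩
    rw [hf ℓ hℓ, sum_incidence_mul (N.no_loop ℓ hℓ)]

theorem sum_mul_laplacian (φ θ : V → ℝ) :
    ∑ i, φ i * N.laplacian θ i =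
      ∑ ℓ ∈ N.lines, N.susceptance ℓ * (θ ℓ.1 - θ ℓ.2) * (φ ℓ.1 - φ ℓ.2) := by
  simp only [laplacian_apply, Finset.mul_sum]
  rw [Finset.sum_comm]
  refine Finset.sum_congr rfl fun ℓ hℓ => ?_
  rw [← sum_incidence_mul (N.no_loop ℓ hℓ) φ, Finset.mul_sum]
  exact Finset.sum_congr rfl fun _ _ => by ring

theorem eq_of_energy_nonpos {θ : V → ℝ} (h : ∑ i, θ i * N.laplacian θ i ≤ 0) :
    ∀ ℓ ∈ N.lines, θ ℓ.1 = θ ℓ.2 := by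
  rw [sum_mul_laplacian] at h
  have hnn : ∀ ℓ ∈ N.lines, 0 ≤ N.susceptance ℓ * (θ ℓ.1 - θ ℓ.2) * (θ ℓ.1 - θ ℓ.2) := by
    intro ℓ hℓ
    rw [mul_assoc]
    exact mul_nonneg (N.susceptance_pos ℓ hℓ).le (mul_self_nonneg _)
  intro ℓ hℓ
  have h0 := (Finset.sum_eq_zero_iff_of_nonneg hnn).1 (le_antisymm h (Finset.sum_nonneg hnn)) ℓ hℓ
  have hb := (N.susceptance_pos ℓ hℓ).ne'
  simp only [mul_eq_zero, hb, false_or, or_self] at h0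
  exact sub_eq_zero.1 h0

theorem eq_of_laplacian_eq_zero {θ : V → ℝ} (h : N.laplacian θ = 0) :
    ∀ ℓ ∈ N.lines, θ ℓ.1 = θ ℓ.2 :=
  N.eq_of_energy_nonpos (by simp [h])

theorem laplacian_injective_on_lines {θ φ : V → ℝ} (h : N.laplacian θ = N.laplacian φ) :
    ∀ ℓ ∈ N.lines, θ ℓ.1 - θ ℓ.2 = φ ℓ.1 - φ ℓ.2 := by
  intro ℓ hℓ
  have := N.eq_of_laplacian_eq_zero (θ := θ - φ) (by rw [map_sub, h, sub_self]) ℓ hℓ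
  simp only [Pi.sub_apply] at this
  linarith

theorem sum_laplacian (θ : V → ℝ) : ∑ i, N.laplacian θ i = 0 := by
  simpa using N.sum_mul_laplacian (fun _ => 1) θ

/-- On a connected graph the kernel of the Laplacian is the constants. Adding the all-ones matrix
`J` removes it, and injectivity gives surjectivity in finite dimension. On a balanced right-hand
side the solution has sum zero, so `J` contributes nothing. -/
theorem exists_laplacian_eq (hconn : N.graph.Connected) {p : V → ℝ} (hp : ∑ i, p i = 0) :
    ∃ θ : V → ℝ, N.laplacian θ = p := by
  let J : (V → ℝ) →ₗ[ℝ] (V → ℝ) := LinearMap.pi fun _ => ∑ i, LinearMap.proj i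
  have hJ : ∀ (θ : V → ℝ) (j : V), J θ j = ∑ i, θ i := fun θ j => by simp [J]
  have hV : Nonempty V := hconn.nonempty
  have hcard : (Fintype.card V : ℝ) ≠ 0 := by exact_mod_cast Fintype.card_ne_zero
  have hsum : ∀ θ q : V → ℝ, (N.laplacian + J) θ = q → ∑ i, q i = 0 → ∑ i, θ i = 0 := by
    rintro θ _ rfl hq
    simpa [Finset.sum_add_distrib, N.sum_laplacian, hJ, hcard] using hq
  have hlap : ∀ θ q : V → ℝ, (N.laplacian + J) θ = q → ∑ i, q i = 0 → N.laplacian θ = q := by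
    intro θ q h hq
    ext j
    have := congrFun h j
    simpa [hJ, hsum θ q h hq] using this
  have hinj : Function.Injective (N.laplacian + J) := by
    refine (injective_iff_map_eq_zero _).2 fun θ hθ => ?_
    have h0 := hsum θ 0 hθ (by simp)
    have hc := N.eq_of_laplacian_eq_zero (hlap θ 0 hθ (by simp))
    ext j
    have hj : ∀ i, θ i = θ j := fun i => N.eq_of_reachable hc (hconn.preconnected i j)
    simpa [hj, hcard] using h0
  obtain ⟨θ, hθ⟩ := LinearMap.injective_iff_surjective.1 hinj p
  exact ⟨θ, hlap θ p hθ hp⟩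

/-! ### Monotone paths and cycles -/

/-- A bus that receives flow is joined to the only sink by a path along which the potential
decreases. -/
theorem exists_descending_path {θ : V → ℝ} {t : V} (ht : ∀ i, i ≠ t → 0 ≤ N.laplacian θ i)
    (v : V) : ∀ u, N.graph.Adj u v → θ v < θ u →
      ∃ w : N.graph.Walk v t, w.IsPath ∧ ∀ i ∈ w.support, θ i ≤ θ v := by
  -- Induction on the potential of `v`, well founded since `V` is finite.
  have hwf : WellFounded fun a b : V => θ a < θ b :=
    haveI : IsTrans V fun a b : V => θ a < θ b := ⟨fun _ _ _ => lt_trans⟩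
    haveI : Std.Irrefl fun a b : V => θ a < θ b := ⟨fun _ => lt_irrefl _⟩
    Finite.wellFounded_of_trans_of_irrefl _
  induction v using hwf.induction with
  | _ v ih =>
    intro u huv hlt
    by_cases hvt : v = t
    · subst hvt
      exact ⟨.nil, by simp, by simp⟩
    · obtain ⟨x, hvx, hx⟩ := N.exists_adj_lt (ht v hvt) huv hlt
      obtain ⟨w, hw, hle⟩ := ih x hx v hvx hx
      refine ⟨.cons hvx w, ?_, ?_⟩
      · rw [SimpleGraph.Walk.cons_isPath_iff]
        exact ⟨hw, fun hmem => absurd (hle v hmem) (not_le.2 hx)⟩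
      · intro i hi
        rw [SimpleGraph.Walk.support_cons, List.mem_cons] at hi
        rcases hi with rfl | hi
        · exact le_rfl
        · exact (hle i hi).trans hx.le

theorem exists_isCycle_of_lt {θ : V → ℝ} {s t u v : V} (hst : N.graph.Adj s t)
    (hθ : N.laplacian θ = Pi.single s 1 - Pi.single t 1)
    (huv : N.graph.Adj u v) (hlt : θ v < θ u) (hne : s(u, v) ≠ s(s, t)) :
    ∃ (x : V) (c : N.graph.Walk x x), c.IsCycle ∧ s(u, v) ∈ c.edges ∧ s(s, t) ∈ c.edges := by
  obtain ⟨down, hdown, hdown'⟩ := N.exists_descending_path (θ := θ) (t := t) (fun i hi => by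
    rw [hθ, Pi.sub_apply, Pi.single_eq_of_ne hi, sub_zero, Pi.single_apply]
    split_ifs <;> simp) v u huv hlt
  -- Negating `θ` reverses the flow: `s` becomes the only sink, and the descending path is an
  -- ascending one for `θ`.
  obtain ⟨up, hup, hup'⟩ := N.exists_descending_path (θ := -θ) (t := s) (fun i hi => by
    rw [map_neg, hθ, Pi.neg_apply, Pi.sub_apply, Pi.single_eq_of_ne hi, zero_sub, neg_neg,
      Pi.single_apply]
    split_ifs <;> simp) u v huv.symm (by simpa using hlt)
  simp only [Pi.neg_apply, neg_le_neg_iff] at hup'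
  -- The `up` part has potential at least `θ u` and the `down` part at most `θ v < θ u`, so they are
  -- disjoint.
  let w : N.graph.Walk s t := up.reverse.append (.cons huv down)
  have hpath : w.IsPath := by
    rw [SimpleGraph.Walk.isPath_def, SimpleGraph.Walk.support_append,
      SimpleGraph.Walk.support_cons, List.tail_cons, SimpleGraph.Walk.support_reverse,
      List.nodup_append]
    refine ⟨List.nodup_reverse.2 hup.support_nodup, hdown.support_nodup, ?_⟩
    rintro a ha b hb rfl
    exact absurd ((hup' a (List.mem_reverse.1 ha)).trans (hdown' a hb)) (not_le.2 hlt)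
  have hedge : s(t, s) ∉ w.edges := by
    rw [Sym2.eq_swap]
    simp only [w, SimpleGraph.Walk.edges_append, SimpleGraph.Walk.edges_reverse,
      SimpleGraph.Walk.edges_cons, List.mem_append, List.mem_reverse, List.mem_cons, not_or]
    -- If `e` lay on `up`, then `t` would be on both sides of the gap; if on `down`, then `s` would.
    refine ⟨fun h => ?_, hne.symm, fun h => ?_⟩
    · have h1 := hup' t (up.snd_mem_support_of_mem_edges h)
      exact absurd (h1.trans (hdown' t down.end_mem_support)) (not_le.2 hlt)
    · have h1 := hdown' s (down.fst_mem_support_of_mem_edges h)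
      exact absurd ((hup' s up.end_mem_support).trans h1) (not_le.2 hlt)
  refine ⟨t, .cons hst.symm w, (SimpleGraph.Walk.cons_isCycle_iff _ _).2 ⟨hpath, hedge⟩, ?_, ?_⟩
  · simp [w]
  · simp [Sym2.eq_swap]

theorem sameBlock_of_ne {θ : V → ℝ} {ℓ e : V × V} (hℓ : ℓ ∈ N.lines) (he : e ∈ N.lines)
    (hθ : N.laplacian θ = Pi.single e.1 1 - Pi.single e.2 1) (h : θ ℓ.1 ≠ θ ℓ.2) :
    N.SameBlock ℓ e := by
  by_cases hne : ℓ = e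
  · exact Or.inl hne
  right
  have hs : s(ℓ.1, ℓ.2) ≠ s(e.1, e.2) := fun hs => hne (N.edge_injective_of_mem hℓ he hs)
  rcases lt_or_gt_of_ne h with h | h
  · have := N.exists_isCycle_of_lt (N.graph_adj_of_mem he) hθ (N.graph_adj_of_mem hℓ).symm h
      (by rwa [Sym2.eq_swap])
    rwa [Sym2.eq_swap] at this
  · exact N.exists_isCycle_of_lt (N.graph_adj_of_mem he) hθ (N.graph_adj_of_mem hℓ) h hs

/-! ### The distribution factors of a unit transfer -/

/-- The energy of `θ` is `θ e.1 - θ e.2`; if it vanished, `θ` would carry no flow at all. -/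
theorem flow_ne_zero {θ : V → ℝ} {e : V × V} (he : e ∈ N.lines)
    (hθ : N.laplacian θ = Pi.single e.1 1 - Pi.single e.2 1) :
    N.susceptance e * (θ e.1 - θ e.2) ≠ 0 := by
  intro h
  have h0 : θ e.1 - θ e.2 = 0 := (mul_eq_zero.1 h).resolve_left (N.susceptance_pos e he).ne'
  have hall := N.eq_of_energy_nonpos (θ := θ) (by
    rw [hθ]
    simp [mul_sub, Finset.sum_sub_distrib, Pi.single_apply, h0])
  refine N.laplacian_ne_zero_of_eq_single_sub he hθ (funext fun i => ?_)
  rw [laplacian_apply]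
  exact Finset.sum_eq_zero fun ℓ hℓ => by rw [hall ℓ hℓ]; simp

/-- If `e` carried the whole transfer, `θ` would be harmonic on the surviving network. That network
still joins the ends of `e`, so their potentials would agree and `e` would carry nothing. -/
theorem flow_ne_one {θ : V → ℝ} {e : V × V} (he : e ∈ N.lines)
    (hbridge : ¬ N.graph.IsBridge s(e.1, e.2))
    (hθ : N.laplacian θ = Pi.single e.1 1 - Pi.single e.2 1) :
    1 - N.susceptance e * (θ e.1 - θ e.2) ≠ 0 := by
  intro h
  have h1 : N.susceptance e * (θ e.1 - θ e.2) = 1 := by linarith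
  have hz : (N.removeLine e).laplacian θ = 0 := by
    rw [N.laplacian_removeLine he, hθ, h1, one_smul, sub_self]
  have heq := (N.removeLine e).eq_of_reachable
    ((N.removeLine e).eq_of_laplacian_eq_zero hz) (N.reachable_removeLine he hbridge)
  rw [heq] at h1
  simp at h1

theorem isPTDF_of_laplacian_eq {θ : V → ℝ} {ℓ : V × V} {s t : V} (hℓ : ℓ ∈ N.lines)
    (hθ : N.laplacian θ = Pi.single s 1 - Pi.single t 1) :
    N.IsPTDF ℓ s t (N.susceptance ℓ * (θ ℓ.1 - θ ℓ.2)) := by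
  intro p δ f f' hδ hf hf'
  obtain ⟨φ, hφ, hfφ⟩ := N.isDCFlow_iff.1 hf
  obtain ⟨φ', hφ', hfφ'⟩ := N.isDCFlow_iff.1 hf'
  have := N.laplacian_injective_on_lines (θ := φ') (φ := φ + δ • θ)
    (by rw [hφ', map_add, map_smul, hφ, hθ]) ℓ hℓ
  rw [hfφ ℓ hℓ, hfφ' ℓ hℓ, this, eq_div_iff hδ]
  simp only [Pi.add_apply, Pi.smul_apply, smul_eq_mul]
  ring

theorem isLODF_of_laplacian_eq {θ : V → ℝ} {ℓ e : V × V} (hℓ : ℓ ∈ N.lines) (he : e ∈ N.lines)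
    (hne : ℓ ≠ e) (hbridge : ¬ N.graph.IsBridge s(e.1, e.2))
    (hθ : N.laplacian θ = Pi.single e.1 1 - Pi.single e.2 1) :
    N.IsLODF ℓ e (N.susceptance ℓ * (θ ℓ.1 - θ ℓ.2) /
      (1 - N.susceptance e * (θ e.1 - θ e.2))) := by
  intro p f f' hf hf' hfe
  have hF := N.flow_ne_one he hbridge hθ
  obtain ⟨φ, hφ, hfφ⟩ := N.isDCFlow_iff.1 hf
  obtain ⟨φ', hφ', hfφ'⟩ := (N.removeLine e).isDCFlow_iff.1 hf'
  have hℓ' : ℓ ∈ (N.removeLine e).lines := Finset.mem_erase.2 ⟨hne, hℓ⟩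
  set F := N.susceptance e * (θ e.1 - θ e.2) with hFdef
  -- The coefficient `c` solves `c * (1 - F) = f e`: the added transfer then compensates for the
  -- lost flow.
  have := (N.removeLine e).laplacian_injective_on_lines (θ := φ')
    (φ := φ + (f e / (1 - F)) • θ) (by
      rw [hφ', map_add, map_smul, N.laplacian_removeLine he, N.laplacian_removeLine he, hφ, hθ,
        ← hfφ e he, ← hFdef]
      ext i
      simp only [Pi.add_apply, Pi.sub_apply, Pi.smul_apply, smul_eq_mul]
      field_simp
      ring) ℓ hℓ'
  rw [hfφ ℓ hℓ, hfφ' ℓ hℓ', this]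
  simp only [Pi.add_apply, Pi.smul_apply, smul_eq_mul, removeLine]
  field_simp
  ring

theorem IsPTDF.unique {θ : V → ℝ} {ℓ : V × V} {s t : V} {D D' : ℝ} (h : N.IsPTDF ℓ s t D)
    (h' : N.IsPTDF ℓ s t D') (hθ : N.laplacian θ = Pi.single s 1 - Pi.single t 1) : D = D' := by
  have h0 : N.IsDCFlow 0 0 := N.isDCFlow_iff.2 ⟨0, map_zero _, by simp⟩
  have h1 : N.IsDCFlow (0 + (1 : ℝ) • (Pi.single s 1 - Pi.single t 1))
      (fun ℓ => N.susceptance ℓ * (θ ℓ.1 - θ ℓ.2)) :=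
    N.isDCFlow_iff.2 ⟨θ, by rw [hθ, zero_add, one_smul], fun _ _ => rfl⟩
  exact (h 0 1 _ _ one_ne_zero h0 h1).trans (h' 0 1 _ _ one_ne_zero h0 h1).symm

/-- Uniqueness needs one admissible outage. The unit transfer across `e` serves: it has nonzero flow
on `e`, and rescaling `θ` solves the surviving network. -/
theorem IsLODF.unique {θ : V → ℝ} {ℓ e : V × V} {K K' : ℝ} (h : N.IsLODF ℓ e K)
    (h' : N.IsLODF ℓ e K') (he : e ∈ N.lines) (hbridge : ¬ N.graph.IsBridge s(e.1, e.2))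
    (hθ : N.laplacian θ = Pi.single e.1 1 - Pi.single e.2 1) : K = K' := by
  have hF := N.flow_ne_one he hbridge hθ
  have h0 : N.IsDCFlow (Pi.single e.1 1 - Pi.single e.2 1)
      (fun ℓ => N.susceptance ℓ * (θ ℓ.1 - θ ℓ.2)) :=
    N.isDCFlow_iff.2 ⟨θ, hθ, fun _ _ => rfl⟩
  set φ := (1 - N.susceptance e * (θ e.1 - θ e.2))⁻¹ • θ with hφ
  have h1 : (N.removeLine e).IsDCFlow (Pi.single e.1 1 - Pi.single e.2 1)
      (fun ℓ => (N.removeLine e).susceptance ℓ * (φ ℓ.1 - φ ℓ.2)) := by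
    refine (N.removeLine e).isDCFlow_iff.2 ⟨φ, ?_, fun _ _ => rfl⟩
    rw [hφ, map_smul, N.laplacian_removeLine he, hθ]
    generalize (Pi.single e.1 1 - Pi.single e.2 1 : V → ℝ) = x
    ext i
    simp only [Pi.sub_apply, Pi.smul_apply, smul_eq_mul]
    field_simp
  have hfe := N.flow_ne_zero he hθ
  exact (h _ _ _ h0 h1 hfe).trans (h' _ _ _ h0 h1 hfe).symm

end

end PowerNetwork

theorem mainTheorem2 {V : Type*} [Fintype V] [DecidableEq V] (N : PowerNetwork V)
    (hconn : N.graph.Connected)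
    (ℓ e : V × V) (hℓ : ℓ ∈ N.lines) (he : e ∈ N.lines) (hne : ℓ ≠ e)
    (hbridge : ¬ N.graph.IsBridge s(e.1, e.2)) :
    (∃! D : ℝ, N.IsPTDF ℓ e.1 e.2 D) ∧
    (∃! K : ℝ, N.IsLODF ℓ e K) ∧
    ∀ D K : ℝ, N.IsPTDF ℓ e.1 e.2 D → N.IsLODF ℓ e K →
      (D = 0 ↔ K = 0) ∧ (¬ N.SameBlock ℓ e → K = 0 ∧ D = 0) := by
  obtain ⟨θ, hθ⟩ := N.exists_laplacian_eq hconn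
    (p := Pi.single e.1 1 - Pi.single e.2 1) (by simp [Finset.sum_sub_distrib])
  have hD := N.isPTDF_of_laplacian_eq hℓ hθ
  have hK := N.isLODF_of_laplacian_eq hℓ he hne hbridge hθ
  refine ⟨⟨_, hD, fun D' hD' => hD'.unique N hD hθ⟩,
    ⟨_, hK, fun K' hK' => hK'.unique N hK he hbridge hθ⟩, fun D K hD' hK' => ?_⟩
  rw [hD'.unique N hD hθ, hK'.unique N hK he hbridge hθ]
  have hF := N.flow_ne_one he hbridge hθ
  refine ⟨by simp [div_eq_zero_iff, hF], fun hblock => ?_⟩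
  have heq : θ ℓ.1 = θ ℓ.2 := by
    by_contra h
    exact hblock (N.sameBlock_of_ne hℓ he hθ h)
  simp [heq]
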